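/- Let $n \ge 0$. A Dyck path of length $n$ is a lattice path with $n$ up-steps $U=(1,1)$ and $n$ down-steps $D=(1,-1)$ that starts at $(0,0)$ and never goes below the horizontal axis. Order these paths by $p \le q$ if and only if $p$ lies weakly above $q$ (that is, after every number of steps the height of $p$ is at least the height of $q$). Let $\operatorname{Tam}_n$ be the set of binary trees with $n$ inner vertices, ordered by $s \le t$ if and only if $t$ is obtained from $s$ by a finite (possibly empty) sequence of right rotations $(AB)C \mapsto A(BC)$, each performed at some inner vertex. Then $\operatorname{Tam}_n$ is a lattice (the Tamari lattice), and the lattice of Dyck paths of length $n$ is isomorphic to the lattice of congruences of $\operatorname{Tam}_n$, ordered by inclusion. -/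

import Mathlib

/-! ### The lattice of congruences of a lattice -/

namespace LatticeCon

variable {α : Type*} [Lattice α]

theorem ext_r {c d : LatticeCon α} (h : ∀ x y, c.r x y ↔ d.r x y) : c = d := by
  obtain ⟨c, _, _⟩ := c
  obtain ⟨d, _, _⟩ := d
  have : c = d := Setoid.ext h
  subst this
  rfl

/-- Congruences are ordered by inclusion (refinement): `c ≤ d` when every pair of elements
identified by `c` is identified by `d`. The least congruence is equality. -/
instance : PartialOrder (LatticeCon α) where
  le c d := ∀ ⦃x y : α⦄, c.r x y → d.r x y
  le_refl _ _ _ h := h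
  le_trans _ _ _ h₁ h₂ _ _ h := h₂ (h₁ h)
  le_antisymm _ _ h₁ h₂ := ext_r fun _ _ => ⟨fun h => h₁ h, fun h => h₂ h⟩

/-- The infimum of a set of congruences is their intersection. -/
instance : InfSet (LatticeCon α) where
  sInf S :=
    { r := fun x y => ∀ c ∈ S, c.r x y
      iseqv :=
        { refl := fun x c _ => c.refl x
          symm := fun h c hc => c.symm (h c hc)
          trans := fun h₁ h₂ c hc => c.trans (h₁ c hc) (h₂ c hc) }
      inf := fun h₁ h₂ c hc => c.inf (h₁ c hc) (h₂ c hc)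
      sup := fun h₁ h₂ c hc => c.sup (h₁ c hc) (h₂ c hc) }

/-- The congruences of a lattice form a complete lattice under inclusion. -/
instance : CompleteLattice (LatticeCon α) :=
  completeLatticeOfInf (LatticeCon α) fun _ =>
    ⟨fun _ hc _ _ h => h _ hc, fun _ hd _ _ h c hc => hd hc h⟩

end LatticeCon

/-! ### Dyck paths -/

/-- The Dyck paths with `n` up-steps and `n` down-steps. -/
structure DyckPath (n : ℕ) where
  /-- The underlying word in the steps `U` and `D`. -/
  word : DyckWord
  semilength_eq : word.semilength = n

namespace DyckPath

variable {n : ℕ}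

/-- The height of the path after its first `i` steps (for `i ≥ 2 * n` this is the final
height `0`). -/
def height (p : DyckPath n) (i : ℕ) : ℤ :=
  ((p.word.toList.take i).count DyckStep.U : ℤ) - ((p.word.toList.take i).count DyckStep.D : ℤ)

theorem length_eq (p : DyckPath n) : p.word.toList.length = 2 * n := by
  have h := p.word.two_mul_semilength_eq_length
  rw [p.semilength_eq] at h
  exact h.symm

theorem height_succ (p : DyckPath n) {i : ℕ} (hi : i < p.word.toList.length) :
    p.height (i + 1) = p.height i + if p.word.toList[i] = DyckStep.U then 1 else -1 := by
  unfold height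
  rw [List.take_add_one, List.getElem?_eq_getElem hi]
  rcases DyckStep.dichotomy p.word.toList[i] with h | h <;> simp [h] <;> ring

theorem ext_height {p q : DyckPath n} (h : ∀ i, p.height i = q.height i) : p = q := by
  have hw : p.word.toList = q.word.toList := by
    refine List.ext_getElem (by rw [p.length_eq, q.length_eq]) fun i h₁ h₂ => ?_
    have e := h (i + 1)
    rw [p.height_succ h₁, q.height_succ h₂, h i] at e
    rcases DyckStep.dichotomy p.word.toList[i] with a | a <;>
      rcases DyckStep.dichotomy q.word.toList[i] with b | b <;> simp_all
  obtain ⟨p, _⟩ := p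
  obtain ⟨q, _⟩ := q
  have : p = q := DyckWord.ext hw
  subst this
  rfl

/-- The order of the lattice of Dyck paths: `p ≤ q` when `p` lies weakly above `q`, i.e. `p` is
at least as high as `q` after every number of steps. The least path is the single peak
`U ⋯ U D ⋯ D` and the greatest path is the zigzag `U D U D ⋯ U D`. -/
instance : PartialOrder (DyckPath n) where
  le p q := ∀ i, q.height i ≤ p.height i
  le_refl _ _ := le_rfl
  le_trans _ _ _ h₁ h₂ i := (h₂ i).trans (h₁ i)
  le_antisymm _ _ h₁ h₂ := ext_height fun i => le_antisymm (h₂ i) (h₁ i)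

end DyckPath

/-! ### The Tamari order -/

/-- `t` is obtained from `s` by a single right rotation, `(A B) C ↦ A (B C)`, performed at some
inner vertex. -/
inductive BinaryTree.Rotates : BinaryTree Unit → BinaryTree Unit → Prop
  | root (A B C : BinaryTree Unit) :
      Rotates (.node () (.node () A B) C) (.node () A (.node () B C))
  | left {L L' : BinaryTree Unit} (R : BinaryTree Unit) :
      Rotates L L' → Rotates (.node () L R) (.node () L' R)
  | right (L : BinaryTree Unit) {R R' : BinaryTree Unit} :
      Rotates R R' → Rotates (.node () L R) (.node () L R')

/-- The binary trees with `n` inner vertices. -/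
structure TamariTree (n : ℕ) where
  /-- The underlying binary tree; its inner vertices are the `node`s, its leaves the `nil`s. -/
  tree : BinaryTree Unit
  numNodes_eq : tree.numNodes = n

namespace TamariTree

variable {n : ℕ}

theorem ext_tree {s t : TamariTree n} (h : s.tree = t.tree) : s = t := by
  cases s
  cases t
  cases h
  rfl

/-- The sum of the sizes of the right subtrees of all inner vertices. -/
def weight : BinaryTree Unit → ℕ
  | .nil => 0
  | .node _ l r => weight l + weight r + r.numNodes

theorem rotates_weight {s t : BinaryTree Unit} (h : s.Rotates t) :
    s.numNodes = t.numNodes ∧ weight s < weight t := by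
  induction h with
  | root A B C => simp only [weight, BinaryTree.numNodes]; omega
  | left R _ ih => simp only [weight, BinaryTree.numNodes]; omega
  | right L _ ih => simp only [weight, BinaryTree.numNodes]; omega

theorem weight_of_chain {s t : BinaryTree Unit}
    (h : Relation.ReflTransGen BinaryTree.Rotates s t) : s = t ∨ weight s < weight t := by
  induction h with
  | refl => exact Or.inl rfl
  | tail _ h ih =>
    have := (rotates_weight h).2
    rcases ih with rfl | ih
    · exact Or.inr this
    · exact Or.inr (ih.trans this)

/-- The Tamari order on the binary trees with `n` inner vertices: `s ≤ t` when `t` is obtained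
from `s` by a finite sequence of right rotations (which preserve the number of inner vertices). -/
instance tamariOrder (n : ℕ) : PartialOrder (TamariTree n) where
  le s t := Relation.ReflTransGen BinaryTree.Rotates s.tree t.tree
  le_refl _ := Relation.ReflTransGen.refl
  le_trans _ _ _ := Relation.ReflTransGen.trans
  le_antisymm s t h₁ h₂ := by
    apply ext_tree
    rcases weight_of_chain h₁ with h | h
    · exact h
    · rcases weight_of_chain h₂ with h' | h'
      · exact h'.symm
      · omega

end TamariTree

/-!
Number the inner vertices of a binary tree in in-order and write `i → j` when vertex `j` lies in the
right subtree of vertex `i`. The bracket vector, which lists the sizes of the right subtrees, encodes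
this relation, and a tree is below another in the Tamari order exactly when its relation is contained
in the other one (`TamariTree.le_iff`): if the bracket vectors compare, the root of the larger tree
lies on the left spine of the smaller one, so rotations lift it to the root there, and one continues
in the subtrees. The relations that occur are the transitive relations contained in `<` such that
`i → k` and `i < j ≤ k` imply `i → j` (`TamariTree.exists_rightDesc_iff`). They are closed under
intersection and under transitive closure of unions, which gives the lattice structure.

The join-irreducible elements are the relations `J a b = {a → j | a < j ≤ b}` for `a < b`, with lower
cover `J a (b - 1)`. A congruence that identifies two trees with `a → b` in one but not in the other
contracts `J a b`, i.e. identifies it with its lower cover (`TamariTree.contracts_of_rel`). Joining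
such a covering pair with `J a' a` or with `J b b'` shows that contracting `J a b` forces the
contraction of every `J a' b'` with `a' ≤ a` and `b ≤ b'`. Conversely, if a set `S` of pairs is closed
under this forcing, then "the relations agree outside `S`" is a congruence (`TamariTree.conOf`):
a path from `a` to `b` with `(a, b)` outside `S` has all of its steps outside `S`, so it survives in
the join. A congruence is recovered from the pairs it contracts (`TamariTree.conOf_contracts`), so
congruences correspond to sets of intervals `[a, b]` closed under enlarging the interval.

These intervals are the unit cells between the zigzag path and the single peak, and the sets closed
under enlargement are the sets of cells above a Dyck path (`DyckPath.le_iff_below`,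
`DyckPath.exists_below_iff`); the path of a given set is found greedily.
-/

/-! ### Bracket vectors of binary trees -/

namespace BinaryTree

/-- The bracket vector of a binary tree: the size of the right subtree of the `i`-th inner vertex,
where the inner vertices are numbered from `0` in in-order. The value is `0` beyond the last
inner vertex. -/
def rightSize : BinaryTree Unit → ℕ → ℕ
  | .nil, _ => 0
  | .node _ l r, i =>
    if i < l.numNodes then rightSize l i
    else if i = l.numNodes then r.numNodes
    else rightSize r (i - l.numNodes - 1)

variable {l r s t : BinaryTree Unit}

theorem rightSize_node_of_lt {i : ℕ} (h : i < l.numNodes) :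
    rightSize (.node () l r) i = rightSize l i := by
  simp [rightSize, h]

theorem rightSize_node_self : rightSize (.node () l r) l.numNodes = r.numNodes := by
  simp [rightSize]

theorem rightSize_node_add (i : ℕ) :
    rightSize (.node () l r) (l.numNodes + 1 + i) = rightSize r i := by
  have h₁ : ¬ l.numNodes + 1 + i < l.numNodes := by omega
  have h₂ : ¬ l.numNodes + 1 + i = l.numNodes := by omega
  have h₃ : l.numNodes + 1 + i - l.numNodes - 1 = i := by omega
  simp only [rightSize, h₁, h₂, h₃, if_false]

/-- Case distinction on the position of an inner vertex relative to the root. -/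
theorem position_cases (m i : ℕ) : i < m ∨ i = m ∨ ∃ k, i = m + 1 + k := by
  rcases lt_trichotomy i m with h | h | h
  · exact Or.inl h
  · exact Or.inr (Or.inl h)
  · exact Or.inr (Or.inr ⟨i - m - 1, by omega⟩)

theorem add_rightSize_lt (t : BinaryTree Unit) {i : ℕ} (hi : i < t.numNodes) :
    i + rightSize t i < t.numNodes := by
  induction t generalizing i with
  | nil => simp at hi
  | node _ l r ihl ihr =>
    simp only [numNodes] at hi ⊢
    rcases position_cases l.numNodes i with h | rfl | ⟨k, rfl⟩
    · have := ihl h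
      rw [rightSize_node_of_lt h]; omega
    · rw [rightSize_node_self]; omega
    · have := ihr (i := k) (by omega)
      rw [rightSize_node_add]; omega

theorem rightSize_of_le (t : BinaryTree Unit) {i : ℕ} (hi : t.numNodes ≤ i) :
    rightSize t i = 0 := by
  induction t generalizing i with
  | nil => rfl
  | node _ l r ihl ihr =>
    simp only [numNodes] at hi
    obtain ⟨k, rfl⟩ : ∃ k, i = l.numNodes + 1 + k := ⟨i - l.numNodes - 1, by omega⟩
    rw [rightSize_node_add, ihr (by omega)]

/-- The intervals covered by the right subtrees are nested. -/
theorem add_rightSize_le_of_mem (t : BinaryTree Unit) {i j : ℕ} (hij : i ≤ j)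
    (hj : j ≤ i + rightSize t i) : j + rightSize t j ≤ i + rightSize t i := by
  induction t generalizing i j with
  | nil => simp only [rightSize] at hj ⊢; omega
  | node _ l r ihl ihr =>
    rcases position_cases l.numNodes i with h | rfl | ⟨k, rfl⟩
    · rw [rightSize_node_of_lt h] at hj ⊢
      have := add_rightSize_lt l h
      rw [rightSize_node_of_lt (by omega)]
      exact ihl hij hj
    · rw [rightSize_node_self] at hj ⊢
      rcases hij.eq_or_lt with rfl | hlt
      · rw [rightSize_node_self]
      · obtain ⟨k, rfl⟩ : ∃ k, j = l.numNodes + 1 + k := ⟨j - l.numNodes - 1, by omega⟩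
        have := add_rightSize_lt r (i := k) (by omega)
        rw [rightSize_node_add]; omega
    · obtain ⟨k', rfl⟩ : ∃ k', j = l.numNodes + 1 + k' := ⟨j - l.numNodes - 1, by omega⟩
      rw [rightSize_node_add] at hj ⊢
      rw [rightSize_node_add]
      have := ihr (i := k) (j := k') (by omega) (by omega)
      omega

/-- A function with the two characteristic properties of bracket vectors is one. -/
theorem exists_rightSize_eq (n : ℕ) (v : ℕ → ℕ) (hlt : ∀ i < n, i + v i < n)
    (hv : ∀ i j, i ≤ j → j ≤ i + v i → j < n → j + v j ≤ i + v i) :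
    ∃ t : BinaryTree Unit, t.numNodes = n ∧ ∀ i < n, rightSize t i = v i := by
  induction n using Nat.strong_induction_on generalizing v with
  | _ n ih =>
  rcases Nat.eq_zero_or_pos n with rfl | hn
  · exact ⟨.nil, rfl, by simp⟩
  -- the root is the first vertex whose interval extends to the very end
  have hex : ∃ m, m < n ∧ m + v m + 1 = n := ⟨n - 1, by omega, by have := hlt (n - 1); omega⟩
  classical
  obtain ⟨hmn, hm⟩ := Nat.find_spec hex
  have hmin := fun k => Nat.find_min hex (m := k)
  generalize Nat.find hex = m at hmn hm hmin
  obtain ⟨l, hl, hlv⟩ := ih m hmn v (fun i hi => by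
      by_contra hcon
      have h₁ := hv i m (by omega) (by omega) hmn
      have h₂ := hlt i (by omega)
      exact hmin i hi ⟨by omega, by omega⟩)
    (fun i j hij hj hjm => hv i j hij hj (by omega))
  obtain ⟨r, hr, hrv⟩ := ih (n - m - 1) (by omega) (fun i => v (m + 1 + i))
    (fun i hi => by have := hlt (m + 1 + i) (by omega); omega)
    (fun i j hij hj hjm => by
      have := hv (m + 1 + i) (m + 1 + j) (by omega) (by omega) (by omega); omega)
  refine ⟨.node () l r, by simp only [numNodes]; omega, fun i hi => ?_⟩
  subst hl
  rcases position_cases l.numNodes i with h | rfl | ⟨k, rfl⟩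
  · rw [rightSize_node_of_lt h, hlv i h]
  · rw [rightSize_node_self]; omega
  · rw [rightSize_node_add, hrv k (by omega)]

/-! ### The Tamari order is the componentwise order of bracket vectors -/

theorem Rotates.rightSize_le (h : s.Rotates t) (i : ℕ) : rightSize s i ≤ rightSize t i := by
  induction h generalizing i with
  | root A B C =>
    rcases position_cases A.numNodes i with h | rfl | ⟨k, rfl⟩
    · rw [rightSize_node_of_lt (by simp only [numNodes]; omega), rightSize_node_of_lt h,
        rightSize_node_of_lt h]
    · rw [rightSize_node_of_lt (by simp only [numNodes]; omega), rightSize_node_self,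
        rightSize_node_self]
      simp only [numNodes]; omega
    · rw [rightSize_node_add]
      rcases position_cases B.numNodes k with h | rfl | ⟨k, rfl⟩
      · rw [rightSize_node_of_lt (by simp only [numNodes]; omega), rightSize_node_add,
          rightSize_node_of_lt h]
      · have e : A.numNodes + 1 + B.numNodes = (BinaryTree.node () A B).numNodes := by
          simp only [numNodes]; omega
        rw [e, rightSize_node_self, rightSize_node_self]
      · have e : A.numNodes + 1 + (B.numNodes + 1 + k)
            = (BinaryTree.node () A B).numNodes + 1 + k := by
          simp only [numNodes]; omega
        rw [e, rightSize_node_add, rightSize_node_add]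
  | @left L L' R h ih =>
    have hn := (TamariTree.rotates_weight h).1
    simp only [rightSize, hn]
    split_ifs
    exacts [ih i, le_rfl, le_rfl]
  | @right L R R' h ih =>
    have hn := (TamariTree.rotates_weight h).1
    simp only [rightSize, hn]
    split_ifs
    exacts [le_rfl, le_rfl, ih _]

theorem numNodes_eq_of_chain (h : Relation.ReflTransGen Rotates s t) : s.numNodes = t.numNodes := by
  induction h with
  | refl => rfl
  | tail _ h ih => exact ih.trans (TamariTree.rotates_weight h).1

theorem rightSize_le_of_chain (h : Relation.ReflTransGen Rotates s t) (i : ℕ) :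
    rightSize s i ≤ rightSize t i := by
  induction h with
  | refl => exact le_rfl
  | tail _ h ih => exact ih.trans (h.rightSize_le i)

theorem chain_node_left {l l' : BinaryTree Unit} (r : BinaryTree Unit)
    (h : Relation.ReflTransGen Rotates l l') :
    Relation.ReflTransGen Rotates (.node () l r) (.node () l' r) :=
  Relation.ReflTransGen.lift (fun x => BinaryTree.node () x r) (fun _ _ => Rotates.left r) _ _ h

theorem chain_node_right (l : BinaryTree Unit) {r r' : BinaryTree Unit}
    (h : Relation.ReflTransGen Rotates r r') :
    Relation.ReflTransGen Rotates (.node () l r) (.node () l r') :=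
  Relation.ReflTransGen.lift (fun x => BinaryTree.node () l x) (fun _ _ => Rotates.right l) _ _ h

/-- A vertex `m` that lies in no right subtree of an earlier vertex lies on the left spine, and
right rotations along the spine turn it into the root. This changes the bracket vector at `m`
only. -/
theorem exists_chain_root (s : BinaryTree Unit) {m : ℕ} (hm : m < s.numNodes)
    (h : ∀ k < m, k + rightSize s k < m) :
    ∃ l r : BinaryTree Unit, l.numNodes = m ∧
      Relation.ReflTransGen Rotates s (.node () l r) ∧
      ∀ i, i ≠ m → rightSize (.node () l r) i = rightSize s i := by
  induction s with
  | nil => simp at hm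
  | node _ sl sr ihl _ =>
    simp only [numNodes] at hm
    rcases lt_trichotomy m sl.numNodes with hlt | rfl | hgt
    · obtain ⟨l, r, hl, hc, hr⟩ := ihl hlt fun k hk => by
        have := h k hk
        rwa [rightSize_node_of_lt (by omega)] at this
      have hn := numNodes_eq_of_chain hc
      refine ⟨l, .node () r sr, hl,
        (chain_node_left sr hc).tail (Rotates.root l r sr), fun i hi => ?_⟩
      rcases position_cases l.numNodes i with h' | rfl | ⟨k, rfl⟩
      · rw [rightSize_node_of_lt h', rightSize_node_of_lt (by omega), ← hr i hi,
          rightSize_node_of_lt h']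
      · exact absurd hl hi
      · rw [rightSize_node_add]
        simp only [numNodes] at hn
        rcases position_cases r.numNodes k with h' | rfl | ⟨k, rfl⟩
        · rw [rightSize_node_of_lt h', rightSize_node_of_lt (by omega), ← hr _ hi,
            rightSize_node_add]
        · have e : l.numNodes + 1 + r.numNodes = sl.numNodes := by omega
          rw [e, rightSize_node_self, rightSize_node_self]
        · have e : l.numNodes + 1 + (r.numNodes + 1 + k) = sl.numNodes + 1 + k := by omega
          rw [e, rightSize_node_add, rightSize_node_add]
    · exact ⟨sl, sr, rfl, .refl, fun _ _ => rfl⟩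
    · have := h _ hgt
      rw [rightSize_node_self] at this
      omega

/-- A componentwise inequality of bracket vectors is realized by right rotations. -/
theorem chain_of_rightSize_le (hn : s.numNodes = t.numNodes)
    (h : ∀ i, rightSize s i ≤ rightSize t i) : Relation.ReflTransGen Rotates s t := by
  induction t generalizing s with
  | nil =>
    cases s with
    | nil => exact .refl
    | node _ l r => simp at hn
  | node _ tl tr ihl ihr =>
    have hn' := hn
    simp only [numNodes] at hn'
    -- the root of `t` can be rotated to the root of `s`, and then the subtrees compare
    obtain ⟨l, r, hl, hc, hr⟩ := exists_chain_root s (m := tl.numNodes) (by omega) fun k hk => by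
      have h₁ := h k
      rw [rightSize_node_of_lt hk] at h₁
      have := add_rightSize_lt tl hk
      omega
    have hn'' := numNodes_eq_of_chain hc
    simp only [numNodes] at hn''
    refine hc.trans ((chain_node_left r (ihl hl fun i => ?_)).trans
      (chain_node_right tl (ihr (by omega) fun i => ?_)))
    · by_cases hi : i < tl.numNodes
      · have := h i
        rwa [← hr i hi.ne, rightSize_node_of_lt (hl ▸ hi), rightSize_node_of_lt hi] at this
      · rw [rightSize_of_le l (by omega)]; exact Nat.zero_le _
    · have := h (tl.numNodes + 1 + i)
      rw [← hr _ (by omega), rightSize_node_add] at this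
      rwa [← hl, rightSize_node_add] at this

end BinaryTree

/-! ### The Tamari lattice as a lattice of relations -/

namespace TamariTree

variable {n : ℕ}

/-- The `j`-th inner vertex lies in the right subtree of the `i`-th one, where the inner vertices
are numbered from `0` in in-order. -/
def RightDesc (t : TamariTree n) (i j : ℕ) : Prop :=
  i < j ∧ j ≤ i + t.tree.rightSize i

variable {s t : TamariTree n} {i j k : ℕ}

theorem RightDesc.lt (h : t.RightDesc i j) : i < j := h.1

theorem RightDesc.lt_card (h : t.RightDesc i j) : j < n := by
  obtain ⟨h₁, h₂⟩ := h
  rw [← t.numNodes_eq]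
  by_cases hi : i < t.tree.numNodes
  · exact h₂.trans_lt (t.tree.add_rightSize_lt hi)
  · rw [t.tree.rightSize_of_le (not_lt.1 hi)] at h₂; omega

theorem RightDesc.mono_right (h : t.RightDesc i k) (hij : i < j) (hjk : j ≤ k) :
    t.RightDesc i j :=
  ⟨hij, hjk.trans h.2⟩

theorem RightDesc.trans (h₁ : t.RightDesc i j) (h₂ : t.RightDesc j k) : t.RightDesc i k :=
  ⟨h₁.1.trans h₂.1, h₂.2.trans (t.tree.add_rightSize_le_of_mem h₁.1.le h₁.2)⟩

theorem le_iff : s ≤ t ↔ ∀ i j, s.RightDesc i j → t.RightDesc i j := by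
  refine ⟨fun h i j hij => ⟨hij.1, hij.2.trans ?_⟩, fun h => ?_⟩
  · exact Nat.add_le_add_left (BinaryTree.rightSize_le_of_chain h i) i
  · refine BinaryTree.chain_of_rightSize_le (s.numNodes_eq.trans t.numNodes_eq.symm) fun i => ?_
    by_contra hcon
    have := (h i (i + s.tree.rightSize i) ⟨by omega, le_rfl⟩).2
    omega

/-- The relations `RightDesc` are exactly the transitive relations contained in `<` that are
closed under decreasing the second argument. -/
theorem exists_rightDesc_iff {Q : ℕ → ℕ → Prop} (hlt : ∀ i j, Q i j → i < j)
    (hn : ∀ i j, Q i j → j < n) (hmono : ∀ i j k, Q i k → i < j → j ≤ k → Q i j)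
    (htrans : ∀ i j k, Q i j → Q j k → Q i k) :
    ∃ t : TamariTree n, ∀ i j, t.RightDesc i j ↔ Q i j := by
  classical
  let v : ℕ → ℕ := fun i => Nat.findGreatest (fun k => Q i (i + k)) n
  have hv₀ : ∀ i, v i ≠ 0 → Q i (i + v i) := fun i h =>
    Nat.findGreatest_of_ne_zero (P := fun k => Q i (i + k)) rfl h
  have hv₁ : ∀ i j, Q i j → j ≤ i + v i := fun i j h => by
    have h₁ := hlt i j h
    have h₂ := hn i j h
    have : j - i ≤ v i :=
      Nat.le_findGreatest (by omega) (by rwa [Nat.add_sub_cancel' h₁.le])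
    omega
  obtain ⟨t, ht, htv⟩ := BinaryTree.exists_rightSize_eq n v
    (fun i hi => by
      by_cases h : v i = 0
      · omega
      · exact hn _ _ (hv₀ i h))
    (fun i j hij hj _ => by
      by_cases h : v j = 0
      · omega
      rcases hij.eq_or_lt with rfl | hij
      · exact le_rfl
      have h₁ := hmono i j _ (hv₀ i (by omega)) hij hj
      exact hv₁ _ _ (htrans _ _ _ h₁ (hv₀ j h)))
  refine ⟨⟨t, ht⟩, fun i j => ⟨fun h => ?_, fun h => ⟨hlt i j h, ?_⟩⟩⟩
  · obtain ⟨h₁, h₂⟩ := id h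
    have h₃ := h.lt_card
    rw [htv i (by omega)] at h₂
    exact hmono i j _ (hv₀ i (by omega)) h₁ h₂
  · have := hv₁ i j h
    have h₁ := hlt i j h
    have h₂ := hn i j h
    rwa [htv i (by omega)]

theorem exists_inf (s t : TamariTree n) :
    ∃ u : TamariTree n, ∀ i j, u.RightDesc i j ↔ s.RightDesc i j ∧ t.RightDesc i j :=
  exists_rightDesc_iff (fun _ _ h => h.1.lt) (fun _ _ h => h.1.lt_card)
    (fun _ _ _ h h₁ h₂ => ⟨h.1.mono_right h₁ h₂, h.2.mono_right h₁ h₂⟩)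
    (fun _ _ _ h h' => ⟨h.1.trans h'.1, h.2.trans h'.2⟩)

theorem exists_sup (s t : TamariTree n) :
    ∃ u : TamariTree n, ∀ i j, u.RightDesc i j ↔
      Relation.TransGen (fun i j => s.RightDesc i j ∨ t.RightDesc i j) i j := by
  refine exists_rightDesc_iff (fun i j h => ?_) (fun i j h => ?_) (fun i j k h => ?_)
    (fun _ _ _ => .trans)
  · induction h with
    | single h => exact h.elim RightDesc.lt RightDesc.lt
    | tail _ h ih => exact ih.trans (h.elim RightDesc.lt RightDesc.lt)
  · cases h with
    | single h => exact h.elim RightDesc.lt_card RightDesc.lt_card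
    | tail _ h => exact h.elim RightDesc.lt_card RightDesc.lt_card
  · induction h with
    | single h =>
      exact fun h₁ h₂ => .single (h.imp (·.mono_right h₁ h₂) (·.mono_right h₁ h₂))
    | @tail b c hb h ih =>
      intro h₁ h₂
      rcases le_or_gt j b with hjb | hjb
      · exact ih h₁ hjb
      · exact .tail hb (h.imp (·.mono_right hjb h₂) (·.mono_right hjb h₂))

/-- The Tamari lattice: meets are intersections of the relations `RightDesc`, joins are transitive
closures of their unions. -/
noncomputable instance tamariLattice (n : ℕ) : Lattice (TamariTree n) where
  toPartialOrder := tamariOrder n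
  inf s t := (exists_inf s t).choose
  sup s t := (exists_sup s t).choose
  inf_le_left s t := le_iff.2 fun i j h => (((exists_inf s t).choose_spec i j).1 h).1
  inf_le_right s t := le_iff.2 fun i j h => (((exists_inf s t).choose_spec i j).1 h).2
  le_inf s t u h₁ h₂ := le_iff.2 fun i j h =>
    ((exists_inf t u).choose_spec i j).2 ⟨le_iff.1 h₁ i j h, le_iff.1 h₂ i j h⟩
  le_sup_left s t := le_iff.2 fun i j h =>
    ((exists_sup s t).choose_spec i j).2 (.single (Or.inl h))
  le_sup_right s t := le_iff.2 fun i j h =>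
    ((exists_sup s t).choose_spec i j).2 (.single (Or.inr h))
  sup_le s t u h₁ h₂ := le_iff.2 fun i j h => by
    have hp := ((exists_sup s t).choose_spec i j).1 h
    clear h
    induction hp with
    | single h => exact Or.elim h (le_iff.1 h₁ _ _) (le_iff.1 h₂ _ _)
    | tail _ h ih => exact ih.trans (Or.elim h (le_iff.1 h₁ _ _) (le_iff.1 h₂ _ _))

theorem rightDesc_inf : (s ⊓ t).RightDesc i j ↔ s.RightDesc i j ∧ t.RightDesc i j :=
  (exists_inf s t).choose_spec i j

theorem rightDesc_sup : (s ⊔ t).RightDesc i j ↔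
    Relation.TransGen (fun i j => s.RightDesc i j ∨ t.RightDesc i j) i j :=
  (exists_sup s t).choose_spec i j

/-! ### Join-irreducible elements -/

theorem exists_joinIrr (n a b : ℕ) :
    ∃ t : TamariTree n, ∀ i j, t.RightDesc i j ↔ i = a ∧ a < j ∧ j ≤ b ∧ j < n :=
  exists_rightDesc_iff (fun _ _ h => by omega) (fun _ _ h => by omega)
    (fun _ _ _ h _ _ => by omega) (fun _ _ _ h h' => by omega)

/-- The least element of the Tamari lattice in which vertex `b` lies in the right subtree of
vertex `a`, for `a < b < n`. These are the join-irreducible elements, and the lower cover of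
`joinIrr a (b + 1)` is `joinIrr a b`. If `b ≤ a`, this is the least element of the lattice. -/
noncomputable def joinIrr (a b : ℕ) : TamariTree n :=
  (exists_joinIrr n a b).choose

theorem rightDesc_joinIrr {a b : ℕ} :
    (joinIrr a b : TamariTree n).RightDesc i j ↔ i = a ∧ a < j ∧ j ≤ b ∧ j < n :=
  (exists_joinIrr n a b).choose_spec i j

theorem joinIrr_le_iff {a b : ℕ} (hab : a < b) (hb : b < n) :
    joinIrr a b ≤ t ↔ t.RightDesc a b := by
  refine ⟨fun h => le_iff.1 h _ _ (rightDesc_joinIrr.2 ⟨rfl, hab, le_rfl, hb⟩),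
    fun h => le_iff.2 fun i j hij => ?_⟩
  obtain ⟨rfl, h₁, h₂, -⟩ := rightDesc_joinIrr.1 hij
  exact h.mono_right h₁ h₂

theorem joinIrr_mono {a b c : ℕ} (h : b ≤ c) : (joinIrr a b : TamariTree n) ≤ joinIrr a c :=
  le_iff.2 fun i j hij => by rw [rightDesc_joinIrr] at hij ⊢; omega

theorem joinIrr_of_le {a b : ℕ} (h : b ≤ a) : (joinIrr a b : TamariTree n) ≤ t :=
  le_iff.2 fun i j hij => by rw [rightDesc_joinIrr] at hij; omega

/-- The intervals `(c, a]` and `(a, b]` compose. -/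
theorem joinIrr_le_sup {a b c : ℕ} (hca : c < a) (han : a < n) :
    (joinIrr c b : TamariTree n) ≤ joinIrr c a ⊔ joinIrr a b := by
  refine le_iff.2 fun i j hij => ?_
  obtain ⟨rfl, h₁, h₂, h₃⟩ := rightDesc_joinIrr.1 hij
  rw [rightDesc_sup]
  rcases le_or_gt j a with h | h
  · exact .single (Or.inl (rightDesc_joinIrr.2 ⟨rfl, h₁, h, h₃⟩))
  · exact .tail (.single (Or.inl (rightDesc_joinIrr.2 ⟨rfl, hca, le_rfl, han⟩)))
      (Or.inr (rightDesc_joinIrr.2 ⟨rfl, h, h₂, h₃⟩))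

end TamariTree

/-! ### Congruences of the Tamari lattice -/

namespace TamariTree

variable {n : ℕ}

/-- The forcing relation between the join-irreducible elements `joinIrr a b` of the Tamari lattice
is inclusion of the intervals `[a, b]`. This predicate says that the set `S` of pairs `a < b < n`
is closed under forcing. -/
def IsForcingClosed (n : ℕ) (S : ℕ → ℕ → Prop) : Prop :=
  ∀ ⦃a b a' b'⦄, S a b → a' ≤ a → a < b → b ≤ b' → b' < n → S a' b'

/-- The congruence that identifies two trees when their relations `RightDesc` agree
outside `S`. -/
def conOf (S : ℕ → ℕ → Prop) (hS : IsForcingClosed n S) : LatticeCon (TamariTree n) where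
  r x y := ∀ a b, ¬ S a b → (x.RightDesc a b ↔ y.RightDesc a b)
  iseqv :=
    { refl := fun _ _ _ _ => Iff.rfl
      symm := fun h a b hab => (h a b hab).symm
      trans := fun h₁ h₂ a b hab => (h₁ a b hab).trans (h₂ a b hab) }
  inf h₁ h₂ a b hab := by
    rw [rightDesc_inf, rightDesc_inf, h₁ a b hab, h₂ a b hab]
  sup {w x y z} h₁ h₂ := by
    -- all steps of a path from `a` to `b` span subintervals of `[a, b]`, so none of them is in `S`
    have key : ∀ {w x y z : TamariTree n},
        (∀ a b, ¬ S a b → (w.RightDesc a b ↔ x.RightDesc a b)) →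
        (∀ a b, ¬ S a b → (y.RightDesc a b ↔ z.RightDesc a b)) →
        ∀ a b, ¬ S a b → (w ⊔ y).RightDesc a b → (x ⊔ z).RightDesc a b := by
      intro w x y z h₁ h₂ a b hab h
      have hp := rightDesc_sup.1 h
      clear h
      induction hp with
      | single h =>
        exact rightDesc_sup.2 (.single (h.imp (h₁ _ _ hab).1 (h₂ _ _ hab).1))
      | @tail m b hm h ih =>
        have hlt : a < m := (rightDesc_sup.2 hm).lt
        have hmb : m < b := h.elim RightDesc.lt RightDesc.lt
        have hbn : b < n := h.elim RightDesc.lt_card RightDesc.lt_card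
        have ham : ¬ S a m := fun hs => hab (hS hs le_rfl hlt hmb.le hbn)
        have hmb' : ¬ S m b := fun hs => hab (hS hs hlt.le hmb le_rfl hbn)
        exact (ih ham).trans
          (rightDesc_sup.2 (.single (h.imp (h₁ _ _ hmb').1 (h₂ _ _ hmb').1)))
    exact fun a b hab => ⟨key h₁ h₂ a b hab,
      key (fun a b h => (h₁ a b h).symm) (fun a b h => (h₂ a b h).symm) a b hab⟩

/-- `conOf` is an order embedding; only the pairs `a < b < n` of the sets matter. -/
theorem conOf_le_iff {S S' : ℕ → ℕ → Prop} {hS : IsForcingClosed n S}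
    {hS' : IsForcingClosed n S'} :
    conOf S hS ≤ conOf S' hS' ↔ ∀ a b, a < b → b < n → S a b → S' a b := by
  constructor
  · intro h a b hab hbn hs
    by_contra hs'
    -- `conOf S` collapses the covering pair below `joinIrr a b`
    have h₁ : (conOf S hS).r (joinIrr a (b - 1)) (joinIrr a b) := fun i j hij => by
      rw [rightDesc_joinIrr, rightDesc_joinIrr]
      refine ⟨fun h => by omega, fun h => ?_⟩
      have : j ≠ b := by
        rintro rfl
        exact hij (h.1 ▸ hs)
      omega
    have h₂ := (h h₁ a b hs').2 (rightDesc_joinIrr.2 ⟨rfl, hab, le_rfl, hbn⟩)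
    rw [rightDesc_joinIrr] at h₂
    omega
  · intro h x y hxy a b hab
    refine ⟨fun hx => ?_, fun hy => ?_⟩
    · exact (hxy a b fun hs => hab (h a b hx.lt hx.lt_card hs)).1 hx
    · exact (hxy a b fun hs => hab (h a b hy.lt hy.lt_card hs)).2 hy

/-- The join-irreducible element `joinIrr a b` is identified with its lower cover. -/
def Contracts (c : LatticeCon (TamariTree n)) (a b : ℕ) : Prop :=
  c.r (joinIrr a (b - 1)) (joinIrr a b)

/-- If a congruence identifies two trees that are separated by `joinIrr a b`, it contracts
`joinIrr a b`. -/
theorem contracts_of_rel {c : LatticeCon (TamariTree n)} {x y : TamariTree n} {a b : ℕ}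
    (h : c.r x y) (hx : ¬ x.RightDesc a b) (hy : y.RightDesc a b) : Contracts c a b := by
  have h₁ : (joinIrr a b ⊓ x : TamariTree n) ≤ joinIrr a (b - 1) := le_iff.2 fun i j hij => by
    rw [rightDesc_inf, rightDesc_joinIrr] at hij
    obtain ⟨⟨rfl, h₁, h₂, h₃⟩, h₄⟩ := hij
    have : j ≠ b := by
      rintro rfl
      exact hx h₄
    exact rightDesc_joinIrr.2 ⟨rfl, h₁, by omega, h₃⟩
  have h₂ : (joinIrr a b ⊓ y : TamariTree n) = joinIrr a b :=
    inf_eq_left.2 ((joinIrr_le_iff hy.lt hy.lt_card).2 hy)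
  have h₃ := c.sup (c.refl (joinIrr a (b - 1))) (c.inf (c.refl (joinIrr a b)) h)
  rwa [sup_eq_left.2 h₁, h₂, sup_eq_right.2 (joinIrr_mono (Nat.sub_le b 1))] at h₃

theorem Contracts.forces_left {c : LatticeCon (TamariTree n)} {a b a' : ℕ}
    (h : Contracts c a b) (ha : a' < a) (hab : a < b) (hb : b < n) : Contracts c a' b := by
  refine contracts_of_rel (c.sup (c.refl (joinIrr a' a)) h) (fun hcon => ?_)
    ((joinIrr_le_iff (ha.trans hab) hb).1 (joinIrr_le_sup ha (hab.trans hb)))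
  -- no step of a path in the smaller join ends in `b`
  cases rightDesc_sup.1 hcon with
  | single h => rw [rightDesc_joinIrr, rightDesc_joinIrr] at h; omega
  | tail _ h => rw [rightDesc_joinIrr, rightDesc_joinIrr] at h; omega

theorem Contracts.forces_right {c : LatticeCon (TamariTree n)} {a b b' : ℕ}
    (h : Contracts c a b) (hab : a < b) (hb : b < b') (hb' : b' < n) : Contracts c a b' := by
  refine contracts_of_rel (c.sup h (c.refl (joinIrr b b'))) (fun hcon => ?_)
    ((joinIrr_le_iff (hab.trans hb) hb').1 (joinIrr_le_sup hab (hb.trans hb')))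
  -- no path in the smaller join that starts in `a` gets beyond `b - 1`
  have key : ∀ j, Relation.TransGen (fun i j => (joinIrr a (b - 1) : TamariTree n).RightDesc i j ∨
      (joinIrr b b' : TamariTree n).RightDesc i j) a j → j < b := by
    intro j hj
    induction hj with
    | single h => rw [rightDesc_joinIrr, rightDesc_joinIrr] at h; omega
    | tail _ h ih => rw [rightDesc_joinIrr, rightDesc_joinIrr] at h; omega
  exact absurd (key b' (rightDesc_sup.1 hcon)) (by omega)

/-- Contracting `joinIrr a b` forces the contraction for all larger intervals. -/
theorem isForcingClosed_contracts (c : LatticeCon (TamariTree n)) :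
    IsForcingClosed n (Contracts c) := by
  intro a b a' b' h ha hab hb hb'
  have h₁ : Contracts c a b' := by
    rcases hb.eq_or_lt with rfl | hb
    · exact h
    · exact h.forces_right hab hb hb'
  rcases ha.eq_or_lt with rfl | ha
  · exact h₁
  · exact h₁.forces_left ha (hab.trans_le hb) hb'

/-- Let every join-irreducible element below `x` lie below `y` or be contracted. Then adding one
to `y` does not leave the class of `y`: go down the chain `joinIrr a b`, `joinIrr a (b - 1)`, and so
on, until an element below `y` is reached. -/
theorem rel_sup_joinIrr {c : LatticeCon (TamariTree n)} {x y : TamariTree n}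
    (h : ∀ a b, x.RightDesc a b → y.RightDesc a b ∨ Contracts c a b) {a : ℕ} (b : ℕ)
    (hab : x.RightDesc a b) : c.r y (y ⊔ joinIrr a b) := by
  induction b with
  | zero => exact absurd hab.lt (Nat.not_lt_zero a)
  | succ b ih =>
    rcases h a (b + 1) hab with hy | hc
    · rw [sup_eq_left.2 ((joinIrr_le_iff hy.lt hy.lt_card).2 hy)]
    · refine c.trans ?_ (c.sup (c.refl y) hc)
      rw [Nat.add_sub_cancel]
      rcases (Nat.lt_succ_iff.1 hab.lt).eq_or_lt with rfl | hlt
      · rw [sup_eq_left.2 (joinIrr_of_le le_rfl)]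
      · exact ih (hab.mono_right hlt (Nat.le_succ b))

theorem rel_of_le {c : LatticeCon (TamariTree n)} {x y : TamariTree n} (hyx : y ≤ x)
    (h : ∀ a b, x.RightDesc a b → y.RightDesc a b ∨ Contracts c a b) : c.r y x := by
  classical
  -- the class of `y` contains an upper bound of the finitely many join-irreducibles below `x`
  have key : ∀ F : Finset (ℕ × ℕ), (∀ p ∈ F, x.RightDesc p.1 p.2) →
      ∃ z, y ≤ z ∧ c.r y z ∧ ∀ p ∈ F, joinIrr p.1 p.2 ≤ z := by
    intro F
    induction F using Finset.induction_on with
    | empty => exact fun _ => ⟨y, le_rfl, c.refl y, by simp⟩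
    | insert p F _ ih =>
      intro hF
      obtain ⟨z, h₁, h₂, h₃⟩ := ih fun q hq => hF q (Finset.mem_insert_of_mem hq)
      have hp := rel_sup_joinIrr h p.2 (hF p (Finset.mem_insert_self p F))
      refine ⟨z ⊔ (y ⊔ joinIrr p.1 p.2), h₁.trans le_sup_left, ?_, fun q hq => ?_⟩
      · simpa using c.sup h₂ hp
      · rcases Finset.mem_insert.1 hq with rfl | hq
        · exact le_sup_right.trans le_sup_right
        · exact (h₃ q hq).trans le_sup_left
  obtain ⟨z, h₁, h₂, h₃⟩ := key
    ((Finset.range n ×ˢ Finset.range n).filter fun p => x.RightDesc p.1 p.2)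
    (fun p hp => (Finset.mem_filter.1 hp).2)
  have hxz : x ≤ z := le_iff.2 fun a b hab => by
    refine (joinIrr_le_iff hab.lt hab.lt_card).1 (h₃ (a, b) ?_)
    simp [hab, hab.lt_card, hab.lt.trans hab.lt_card]
  have := c.inf h₂ (c.refl x)
  rwa [inf_eq_left.2 hyx, inf_eq_right.2 hxz] at this

/-- A congruence of the Tamari lattice is determined by the join-irreducible elements that it
contracts. -/
theorem conOf_contracts (c : LatticeCon (TamariTree n)) :
    conOf (Contracts c) (isForcingClosed_contracts c) = c := by
  refine LatticeCon.ext_r fun x y => ⟨fun h => ?_, fun h a b hab => ?_⟩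
  · have h₁ : c.r (x ⊓ y) x := rel_of_le inf_le_left fun a b hx => by
      by_cases hc : Contracts c a b
      · exact Or.inr hc
      · exact Or.inl (rightDesc_inf.2 ⟨hx, (h a b hc).1 hx⟩)
    have h₂ : c.r (x ⊓ y) y := rel_of_le inf_le_right fun a b hy => by
      by_cases hc : Contracts c a b
      · exact Or.inr hc
      · exact Or.inl (rightDesc_inf.2 ⟨(h a b hc).2 hy, hy⟩)
    exact c.trans (c.symm h₁) h₂
  · refine ⟨fun hx => ?_, fun hy => ?_⟩
    · by_contra hy
      exact hab (contracts_of_rel (c.symm h) hy hx)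
    · by_contra hx
      exact hab (contracts_of_rel h hx hy)

end TamariTree

/-! ### Dyck paths and sets of pairs closed under forcing -/

namespace DyckPath

variable {n : ℕ}

/-- The number of up-steps among the first `i` steps of a Dyck path. -/
def ups (p : DyckPath n) (i : ℕ) : ℕ :=
  (p.word.toList.take i).count DyckStep.U

theorem count_U_add_count_D (l : List DyckStep) :
    l.count DyckStep.U + l.count DyckStep.D = l.length := by
  induction l with
  | nil => rfl
  | cons s l ih => cases s <;> simp <;> omega

theorem ups_le_card (p : DyckPath n) (i : ℕ) : p.ups i ≤ n :=
  ((List.take_sublist i _).count_le _).trans p.semilength_eq.le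

theorem ups_le (p : DyckPath n) (i : ℕ) : p.ups i ≤ i :=
  List.count_le_length.trans (List.length_take_le i _)

theorem height_eq (p : DyckPath n) {i : ℕ} (hi : i ≤ 2 * n) :
    p.height i = 2 * (p.ups i : ℤ) - i := by
  have h := count_U_add_count_D (p.word.toList.take i)
  rw [List.length_take, p.length_eq, min_eq_left hi] at h
  unfold height ups
  omega

theorem height_of_le (p : DyckPath n) {i : ℕ} (hi : 2 * n ≤ i) : p.height i = 0 := by
  unfold height
  rw [List.take_of_length_le (p.length_eq.le.trans hi), p.word.count_U_eq_count_D, sub_self]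

theorem le_two_mul_ups (p : DyckPath n) {i : ℕ} (hi : i ≤ 2 * n) : i ≤ 2 * p.ups i := by
  have h₁ := p.word.count_D_le_count_U i
  have h₂ := p.height_eq hi
  unfold height at h₂
  omega

theorem le_iff_ups {p q : DyckPath n} : p ≤ q ↔ ∀ i ≤ 2 * n, q.ups i ≤ p.ups i := by
  refine ⟨fun h i hi => ?_, fun h i => ?_⟩
  · have := h i
    rw [p.height_eq hi, q.height_eq hi] at this
    omega
  · rcases le_total i (2 * n) with hi | hi
    · have := h i hi
      rw [p.height_eq hi, q.height_eq hi]
      omega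
    · rw [p.height_of_le hi, q.height_of_le hi]

theorem ups_mono (p : DyckPath n) {i j : ℕ} (h : i ≤ j) : p.ups i ≤ p.ups j :=
  (List.take_sublist_take_left h).count_le _

theorem ups_add_le (p : DyckPath n) (i k : ℕ) : p.ups (i + k) ≤ p.ups i + k := by
  unfold ups
  rw [List.take_add, List.count_append]
  exact Nat.add_le_add_left (List.count_le_length.trans (List.length_take_le k _)) _

/-- The path passes below the unit cell of the pair `a < b`, the cell with top corner at
position `a + b + 1` and height `b - a + 1`. -/
def Below (p : DyckPath n) (a b : ℕ) : Prop :=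
  p.ups (a + b + 1) ≤ b

theorem isForcingClosed_below (p : DyckPath n) : TamariTree.IsForcingClosed n p.Below := by
  intro a b a' b' h ha _ hb _
  have h₁ : p.ups (a' + b' + 1) ≤ p.ups (a + b + 1 + (b' - b)) := p.ups_mono (by omega)
  have h₂ := p.ups_add_le (a + b + 1) (b' - b)
  unfold Below at h ⊢
  omega

/-- A lower path passes below more cells, and the cells that it passes below determine it. -/
theorem le_iff_below {p q : DyckPath n} :
    p ≤ q ↔ ∀ a b, a < b → b < n → p.Below a b → q.Below a b := by
  rw [le_iff_ups]
  refine ⟨fun h a b hab hb hp => (h _ (by omega)).trans hp, fun h i hi => ?_⟩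
  by_contra hcon
  -- at position `i`, the cell just above `p` lies below `q`
  have h₁ := q.ups_le_card i
  have h₂ := q.ups_le i
  have h₃ := p.le_two_mul_ups hi
  have e : i - 1 - p.ups i + p.ups i + 1 = i := by omega
  have := h (i - 1 - p.ups i) (p.ups i) (by omega) (by omega) (by unfold Below; rw [e])
  unfold Below at this
  rw [e] at this
  omega

/-! ### The Dyck path of a set closed under forcing -/

open Classical in
/-- The number of up-steps among the first `i` steps of the highest path with `n` up-steps that
passes below the cells of all pairs in `S`: it goes up unless no up-step is left or the up-step
would cross a cell of `S`. -/
noncomputable def greedyUps (n : ℕ) (S : ℕ → ℕ → Prop) : ℕ → ℕ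
  | 0 => 0
  | i + 1 =>
    if n ≤ greedyUps n S i ∨
        (i - greedyUps n S i < greedyUps n S i ∧ S (i - greedyUps n S i) (greedyUps n S i))
    then greedyUps n S i else greedyUps n S i + 1

variable {S : ℕ → ℕ → Prop}

theorem greedyUps_succ (S : ℕ → ℕ → Prop) (i : ℕ) :
    greedyUps n S (i + 1) = greedyUps n S i ∧ (n ≤ greedyUps n S i ∨
        (i - greedyUps n S i < greedyUps n S i ∧ S (i - greedyUps n S i) (greedyUps n S i))) ∨
    greedyUps n S (i + 1) = greedyUps n S i + 1 ∧ greedyUps n S i < n ∧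
      (i - greedyUps n S i < greedyUps n S i → ¬ S (i - greedyUps n S i) (greedyUps n S i)) := by
  rw [greedyUps]
  split_ifs with h
  · exact Or.inl ⟨rfl, h⟩
  · rw [not_or, not_and, not_le] at h
    exact Or.inr ⟨rfl, h⟩

theorem greedyUps_le (S : ℕ → ℕ → Prop) (i : ℕ) :
    greedyUps n S i ≤ i ∧ greedyUps n S i ≤ n ∧ (i ≤ 2 * n → i ≤ 2 * greedyUps n S i) := by
  induction i with
  | zero => simp [greedyUps]
  | succ i ih => rcases greedyUps_succ (n := n) S i with h | h <;> omega

/-- The greedy path passes below the cells of the pairs in `S`: in order to cross the cell of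
`(a, b)` it would have to go up after `b` up-steps and at most `a` down-steps. -/
theorem greedyUps_le_of_mem (hS : TamariTree.IsForcingClosed n S) {a b : ℕ} (hab : a < b)
    (hb : b < n) (h : S a b) (i : ℕ) (hi : i ≤ a + b + 1) : greedyUps n S i ≤ b := by
  induction i with
  | zero => simp [greedyUps]
  | succ i ih =>
    have hle := ih (by omega)
    rcases greedyUps_succ (n := n) S i with h' | ⟨h₁, -, h₂⟩
    · omega
    · rcases hle.eq_or_lt with heq | hlt
      · rw [heq] at h₂
        exact absurd (hS h (by omega) hab le_rfl hb) (h₂ (by omega))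
      · omega

/-- The greedy path crosses the cells of the pairs outside `S`: in order to pass below the cell
of `(a, b)` it would have to go down after `a` down-steps and at most `b` up-steps. The conclusion
says that at most `a` of the first `i` steps are down-steps. -/
theorem le_greedyUps_add_of_notMem (hS : TamariTree.IsForcingClosed n S) {a b : ℕ}
    (hb : b < n) (h : ¬ S a b) (i : ℕ) (hi : i ≤ a + b + 1) : i ≤ greedyUps n S i + a := by
  induction i with
  | zero => exact Nat.zero_le _
  | succ i ih =>
    have hle := ih (by omega)
    rcases greedyUps_succ (n := n) S i with ⟨h₁, h₂⟩ | h'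
    · rcases hle.eq_or_lt with heq | hlt
      · have e : i - greedyUps n S i = a := by omega
        rw [e] at h₂
        rcases h₂ with h₂ | ⟨h₂, h₃⟩
        · omega
        · exact absurd (hS h₃ le_rfl h₂ (by omega) hb) h
      · omega
    · omega

/-- The word of the path with up-step counts `greedyUps n S`. -/
noncomputable def greedyWord (n : ℕ) (S : ℕ → ℕ → Prop) : List DyckStep :=
  (List.range (2 * n)).map fun i =>
    if greedyUps n S (i + 1) = greedyUps n S i then DyckStep.D else DyckStep.U

theorem count_U_take_greedyWord (S : ℕ → ℕ → Prop) {i : ℕ} (hi : i ≤ 2 * n) :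
    ((greedyWord n S).take i).count DyckStep.U = greedyUps n S i := by
  unfold greedyWord
  rw [← List.map_take, List.take_range, min_eq_left hi]
  clear hi
  induction i with
  | zero => simp [greedyUps]
  | succ i ih =>
    rw [List.range_succ, List.map_append, List.count_append, ih]
    rcases greedyUps_succ (n := n) S i with h | h <;> simp [h.1]

theorem length_greedyWord (S : ℕ → ℕ → Prop) : (greedyWord n S).length = 2 * n := by
  simp [greedyWord]

/-- Every set of pairs that is closed under forcing comes from a Dyck path. -/
theorem exists_below_iff (hS : TamariTree.IsForcingClosed n S) :
    ∃ p : DyckPath n, ∀ a b, a < b → b < n → (p.Below a b ↔ S a b) := by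
  have hU : (greedyWord n S).count DyckStep.U = n := by
    have h₁ := count_U_take_greedyWord (n := n) S le_rfl
    rw [List.take_of_length_le (length_greedyWord S).le] at h₁
    have h₂ := greedyUps_le (n := n) S (2 * n)
    omega
  refine ⟨⟨⟨greedyWord n S, ?_, fun i => ?_⟩, hU⟩, fun a b hab hb => ?_⟩
  · have := count_U_add_count_D (greedyWord n S)
    rw [length_greedyWord] at this
    omega
  · rcases le_total i (2 * n) with hi | hi
    · have h₁ := count_U_add_count_D ((greedyWord n S).take i)
      have h₂ := greedyUps_le (n := n) S i
      rw [count_U_take_greedyWord S hi, List.length_take, length_greedyWord] at h₁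
      rw [count_U_take_greedyWord S hi]
      omega
    · have := count_U_add_count_D (greedyWord n S)
      rw [List.take_of_length_le ((length_greedyWord S).le.trans hi)]
      rw [length_greedyWord] at this
      omega
  · change ((greedyWord n S).take (a + b + 1)).count DyckStep.U ≤ b ↔ S a b
    rw [count_U_take_greedyWord S (by omega)]
    refine ⟨fun h => ?_, fun h => greedyUps_le_of_mem hS hab hb h _ le_rfl⟩
    by_contra hs
    have := le_greedyUps_add_of_notMem hS hb hs _ le_rfl
    omega

end DyckPath

/-! ### The isomorphism -/

/-- The order embedding of Dyck paths into congruences: a path contracts the join-irreducible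
elements whose cells lie above it. -/
noncomputable def DyckPath.toLatticeCon (n : ℕ) : DyckPath n ↪o LatticeCon (TamariTree n) :=
  OrderEmbedding.ofMapLEIff (fun p => TamariTree.conOf p.Below p.isForcingClosed_below)
    fun _ _ => TamariTree.conOf_le_iff.trans DyckPath.le_iff_below.symm

theorem DyckPath.toLatticeCon_surjective (n : ℕ) :
    Function.Surjective (DyckPath.toLatticeCon n) := by
  intro c
  obtain ⟨p, hp⟩ := DyckPath.exists_below_iff (TamariTree.isForcingClosed_contracts c)
  refine ⟨p, Eq.trans ?_ (TamariTree.conOf_contracts c)⟩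
  change TamariTree.conOf p.Below p.isForcingClosed_below = _
  exact le_antisymm
    (TamariTree.conOf_le_iff.2 fun a b hab hb => (hp a b hab hb).1)
    (TamariTree.conOf_le_iff.2 fun a b hab hb => (hp a b hab hb).2)

theorem theorem2 (n : ℕ) :
    ∃ T : Lattice (TamariTree n),
      T.toPartialOrder = TamariTree.tamariOrder n ∧
        Nonempty (DyckPath n ≃o LatticeCon (TamariTree n)) := by
  exact ⟨TamariTree.tamariLattice n, rfl,
    ⟨RelIso.ofSurjective (DyckPath.toLatticeCon n) (DyckPath.toLatticeCon_surjective n)⟩⟩
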